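/- Let $G$ be a finite group. A \emph{spherical system of generators} of $G$ is a tuple $T=(g_1,\dots,g_r)$ of non-trivial elements of $G$ with $\langle g_1,\dots,g_r\rangle=G$ and $g_1g_2\cdots g_r=1$; put $$\Sigma(T)=\bigcup_{g\in G}\bigcup_{i=1}^{r} g^{-1}\langle g_i\rangle g .$$ A \emph{ramification structure} of size $(r_1,r_2)$ for $G$ is a pair $(T_1,T_2)$ of spherical systems of generators of $G$, of lengths $r_1$ and $r_2$, such that $\Sigma(T_1)\cap\Sigma(T_2)=\{1\}$; $G$ \emph{admits a ramification structure} if it has one of some size $(r_1,r_2)$. For every prime $p\ge 5$ and every positive integer $m$ there exists a finite $p$-group $G$ with the following properties: the minimum number of generators of $G$ is $2$; if $\exp G=p^{e}$, then $e\ge 1$ and $|\{g^{p^{e-1}} \mid g\in G\}|=p^{m}$; and $G$ does not admit a ramification structure. -/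

import Mathlib

/-- A tuple `T = (g₁, …, g_r)` of non-trivial elements of `G` (given as a list) is a spherical
system of generators of `G` if it generates `G` and `g₁ g₂ ⋯ g_r = 1`. -/
structure IsSphericalSystem {G : Type*} [Group G] (T : List G) : Prop where
  ne_one : ∀ x ∈ T, x ≠ 1
  closure_eq_top : Subgroup.closure {x : G | x ∈ T} = ⊤
  prod_eq_one : T.prod = 1

/-- `Σ(T)`: the union of all conjugates of the cyclic subgroups generated by the elements
of the tuple `T`. -/
def sigmaSet {G : Type*} [Group G] (T : List G) : Set G :=
  ⋃ g : G, ⋃ x ∈ T, {y : G | ∃ z ∈ Subgroup.zpowers x, y = g⁻¹ * z * g}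

/-- `(T₁, T₂)` is an (unmixed) ramification structure of size `(r₁, r₂)` for `G`: both are spherical
systems of generators of `G`, of lengths `r₁` and `r₂`, and they are disjoint, that is,
`Σ(T₁) ∩ Σ(T₂) = 1`. -/
structure IsRamificationStructure {G : Type*} [Group G] (r₁ r₂ : ℕ) (T₁ T₂ : List G) : Prop where
  left_spherical : IsSphericalSystem T₁
  right_spherical : IsSphericalSystem T₂
  left_length : T₁.length = r₁
  right_length : T₂.length = r₂
  disjoint : sigmaSet T₁ ∩ sigmaSet T₂ = {1}

/-- The group `G` admits a ramification structure (of some size). -/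
def AdmitsRamificationStructure (G : Type*) [Group G] : Prop :=
  ∃ (r₁ r₂ : ℕ) (T₁ T₂ : List G), IsRamificationStructure r₁ r₂ T₁ T₂

/-! Let `ζ` be a primitive `p ^ (m + 1)`-th root of unity and `R` the quotient of `ℤ[ζ]` by `p ^ (m
+ 2) * (ζ - 1) ^ m`. In `G = R ⋊ ⟨x⟩`, `x` acts as `ζ` but has order `p ^ (m + 2)`, so `z = x ^ p ^
(m + 1)` is non-trivial and acts trivially. Geometric sums of roots of unity vanish, so `z` is a
power of every element outside a maximal subgroup. A generating tuple has an entry outside it, hence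
`z` lies in every `Σ(T)`. The `p ^ (m + 2)`-th powers form `p ^ (m + 2) R ≅ ℤ[ζ] / (ζ - 1) ^ m`, of
order `p ^ m`. -/

open Multiplicative (ofAdd toAdd)

/-! ### Semidirect products by a unit -/

section UnitExtension

variable {R : Type*} [CommRing R]

/-- The character of `ℤ/N` sending `1` to a unit `u` with `u ^ N = 1`. -/
def unitCharacter (N : ℕ) (u : Rˣ) (hu : u ^ N = 1) : Multiplicative (ZMod N) →* Rˣ :=
  AddMonoidHom.toMultiplicativeLeft
    (ZMod.lift N ⟨zmultiplesHom (Additive Rˣ) (Additive.ofMul u), by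
      simp [← ofMul_pow, hu]⟩)

theorem unitCharacter_natCast (N : ℕ) (u : Rˣ) (hu : u ^ N = 1) (n : ℕ) :
    unitCharacter N u hu (ofAdd (n : ZMod N)) = u ^ n := by
  have h := ZMod.lift_coe N (⟨zmultiplesHom (Additive Rˣ) (Additive.ofMul u), by
      simp [← ofMul_pow, hu]⟩ : { f : ℤ →+ Additive Rˣ // f N = 0 }) (n : ℤ)
  rw [Int.cast_natCast] at h
  refine (congrArg Additive.toMul h).trans ?_
  simp

/-- The action of `ℤ/N` on the additive group of `R` through multiplication by powers of `u`. -/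
def unitAction (N : ℕ) (u : Rˣ) (hu : u ^ N = 1) :
    Multiplicative (ZMod N) →* MulAut (Multiplicative R) :=
  (MulAutMultiplicative R).symm.toMonoidHom.comp
    ((DistribMulAction.toAddAut Rˣ R).comp (unitCharacter N u hu))

theorem unitAction_natCast (N : ℕ) (u : Rˣ) (hu : u ^ N = 1) (n : ℕ) (a : R) :
    unitAction N u hu (ofAdd (n : ZMod N)) (ofAdd a) = ofAdd ((u : R) ^ n * a) := by
  have : unitAction N u hu (ofAdd (n : ZMod N)) (ofAdd a)
      = ofAdd (unitCharacter N u hu (ofAdd (n : ZMod N)) • a) := rfl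
  rw [this, unitCharacter_natCast, Units.smul_def, Units.val_pow_eq_pow_val, smul_eq_mul]

/-- The extension of `ℤ/N` by the additive group of `R`, the generator of `ℤ/N` acting as `u`. -/
abbrev UnitExtension (N : ℕ) (u : Rˣ) (hu : u ^ N = 1) : Type _ :=
  Multiplicative R ⋊[unitAction N u hu] Multiplicative (ZMod N)

namespace UnitExtension

variable {N : ℕ} {u : Rˣ} {hu : u ^ N = 1}

variable (hu) in
/-- The element of the extension with components `a` and `n`. -/
def mk (a : R) (n : ℕ) : UnitExtension N u hu := ⟨ofAdd a, ofAdd (n : ZMod N)⟩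

theorem exists_eq_mk [NeZero N] (g : UnitExtension N u hu) : ∃ a n, g = mk hu a n := by
  obtain ⟨n, hn⟩ := ZMod.natCast_zmod_surjective (toAdd g.right)
  exact ⟨toAdd g.left, n, SemidirectProduct.ext rfl (congrArg ofAdd hn.symm)⟩

theorem mk_inj (a b : R) (n k : ℕ) :
    mk hu a n = mk hu b k ↔ a = b ∧ (n : ZMod N) = k := by
  constructor
  · intro h
    exact ⟨congrArg (fun g => toAdd (SemidirectProduct.left g)) h,
      congrArg (fun g => toAdd (SemidirectProduct.right g)) h⟩
  · rintro ⟨rfl, h⟩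
    rw [mk, h, mk]

theorem one_eq_mk : (1 : UnitExtension N u hu) = mk hu 0 0 :=
  SemidirectProduct.ext rfl (by simp [mk])

theorem mk_mul_mk (a b : R) (n k : ℕ) :
    mk hu a n * mk hu b k = mk hu (a + (u : R) ^ n * b) (n + k) := by
  refine SemidirectProduct.ext ?_ ?_
  · rw [SemidirectProduct.mul_left]
    simp only [mk, unitAction_natCast]
    rfl
  · rw [SemidirectProduct.mul_right]
    simp [mk]

theorem mk_pow (a : R) (n k : ℕ) :
    mk hu a n ^ k = mk hu ((∑ i ∈ Finset.range k, ((u : R) ^ n) ^ i) * a) (k * n) := by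
  induction k with
  | zero => simp [one_eq_mk]
  | succ k ih =>
    rw [pow_succ, ih, mk_mul_mk, Finset.sum_range_succ, ← pow_mul, mul_comm n k, add_mul,
      add_mul, one_mul]

theorem mk_pow_of_pow_eq_one (a : R) (n k : ℕ) (h : (u : R) ^ n = 1) :
    mk hu a n ^ k = mk hu (k * a) (k * n) := by
  simp [mk_pow, h]

instance [Finite R] [NeZero N] : Finite (UnitExtension N u hu) :=
  Finite.of_equiv _ SemidirectProduct.equivProd.symm

/-- Conjugation by `mk hu 0 1` is multiplication by `u`, so the part of the closure inside `R` is a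
`u`-stable subgroup containing 1. -/
theorem closure_eq_top [NeZero N]
    (hgen : ∀ S : AddSubgroup R, 1 ∈ S → (∀ a ∈ S, (u : R) * a ∈ S) → S = ⊤) :
    Subgroup.closure {mk hu 1 0, mk hu 0 1} = ⊤ := by
  set H := Subgroup.closure {mk hu 1 0, mk hu 0 1} with hH
  have ha : mk hu 1 0 ∈ H := Subgroup.subset_closure (by simp)
  have hx : mk hu 0 1 ∈ H := Subgroup.subset_closure (by simp)
  let S : AddSubgroup R := Subgroup.toAddSubgroup' (H.comap SemidirectProduct.inl)
  have hmem (a : R) : a ∈ S ↔ mk hu a 0 ∈ H := by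
    have : mk hu a 0 = SemidirectProduct.inl (ofAdd a) :=
      SemidirectProduct.ext rfl (by simp [mk])
    rw [this]; rfl
  have hS : S = ⊤ := by
    refine hgen S ((hmem 1).2 ha) fun a haS => (hmem _).2 ?_
    have : mk hu ((u : R) * a) 0 = mk hu 0 1 * mk hu a 0 * (mk hu 0 1)⁻¹ := by
      rw [eq_mul_inv_iff_mul_eq, mk_mul_mk, mk_mul_mk]
      simp
    rw [this]
    exact H.mul_mem (H.mul_mem hx ((hmem a).1 haS)) (H.inv_mem hx)
  rw [eq_top_iff]
  rintro g -
  obtain ⟨a, n, rfl⟩ := exists_eq_mk g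
  have : mk hu a n = mk hu a 0 * mk hu 0 1 ^ n := by
    rw [mk_pow, mk_mul_mk]; simp
  rw [this]
  exact H.mul_mem ((hmem a).1 (hS ▸ AddSubgroup.mem_top a)) (H.pow_mem hx n)

theorem rank_eq_two [Finite R] [NeZero N] (hu1 : u ≠ 1)
    (hgen : ∀ S : AddSubgroup R, 1 ∈ S → (∀ a ∈ S, (u : R) * a ∈ S) → S = ⊤) :
    Group.rank (UnitExtension N u hu) = 2 := by
  classical
  apply le_antisymm
  · refine (Group.rank_le (S := {mk hu 1 0, mk hu 0 1}) ?_).trans Finset.card_le_two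
    simpa using closure_eq_top hgen
  · by_contra! hlt
    obtain ⟨S, hS, hS'⟩ := Group.rank_spec (UnitExtension N u hu)
    -- Rank below 2 would make the group cyclic, but `u ≠ 1` makes it non-abelian.
    have hcomm : ∀ x y : UnitExtension N u hu, x * y = y * x := by
      have : ∃ g, Subgroup.zpowers g = (⊤ : Subgroup (UnitExtension N u hu)) := by
        rw [← hS']
        obtain h | h : S.card = 0 ∨ S.card = 1 := by omega
        · exact ⟨1, by simp [Finset.card_eq_zero.1 h]⟩
        · obtain ⟨g, rfl⟩ := Finset.card_eq_one.1 h
          exact ⟨g, by simp [Subgroup.zpowers_eq_closure]⟩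
      obtain ⟨g, hg⟩ := this
      intro x y
      obtain ⟨i, rfl⟩ := Subgroup.mem_zpowers_iff.1 (hg ▸ Subgroup.mem_top x)
      obtain ⟨j, rfl⟩ := Subgroup.mem_zpowers_iff.1 (hg ▸ Subgroup.mem_top y)
      exact zpow_mul_comm g i j
    have h := hcomm (mk hu 0 1) (mk hu 1 0)
    rw [mk_mul_mk, mk_mul_mk, mk_inj] at h
    exact hu1 (Units.ext (by simpa using h.1))

end UnitExtension

/-- If a fixed element `z ≠ 1` is a power of every element outside a proper subgroup, then no
ramification structure exists. -/
theorem not_admitsRamificationStructure_of_mem_zpowers {G : Type*} [Group G] (M : Subgroup G)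
    (hM : M ≠ ⊤) (z : G) (hz : z ≠ 1) (h : ∀ g ∉ M, z ∈ Subgroup.zpowers g) :
    ¬ AdmitsRamificationStructure G := by
  rintro ⟨r₁, r₂, T₁, T₂, hT⟩
  have key (T : List G) (hT : IsSphericalSystem T) : z ∈ sigmaSet T := by
    have : ∃ x ∈ T, x ∉ M := by
      by_contra! hc
      refine hM (eq_top_iff.2 ?_)
      rw [← hT.closure_eq_top]
      exact (Subgroup.closure_le M).2 hc
    obtain ⟨x, hx, hxM⟩ := this
    simp only [sigmaSet, Set.mem_iUnion]
    exact ⟨1, x, hx, z, h x hxM, by simp⟩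
  have : z ∈ sigmaSet T₁ ∩ sigmaSet T₂ := ⟨key _ hT.left_spherical, key _ hT.right_spherical⟩
  rw [hT.disjoint] at this
  exact hz this

/-! ### Powers when the geometric sums of `u` vanish -/

namespace UnitExtension

variable {p k : ℕ} {u : Rˣ} {hu : u ^ p ^ (k + 1) = 1}

theorem not_admitsRamificationStructure (hp : p.Prime)
    (htr : ∀ n : ℕ, ¬ p ^ k ∣ n → ∑ i ∈ Finset.range (p ^ k), ((u : R) ^ n) ^ i = 0)
    (hk : k ≠ 0) : ¬ AdmitsRamificationStructure (UnitExtension (p ^ (k + 1)) u hu) := by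
  have : NeZero (p ^ (k + 1)) := ⟨pow_ne_zero _ hp.ne_zero⟩
  let f : Multiplicative (ZMod (p ^ (k + 1))) →* Multiplicative (ZMod p) :=
    AddMonoidHom.toMultiplicative
      (ZMod.castHom (dvd_pow_self p k.succ_ne_zero) (ZMod p)).toAddMonoidHom
  let M : Subgroup (UnitExtension (p ^ (k + 1)) u hu) :=
    (f.comp SemidirectProduct.rightHom).ker
  have hmem (a : R) (n : ℕ) : mk hu a n ∈ M ↔ p ∣ n := by
    rw [← ZMod.natCast_eq_zero_iff]
    have : (f.comp SemidirectProduct.rightHom) (mk hu a n) = ofAdd (n : ZMod p) :=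
      congrArg ofAdd (map_natCast (ZMod.castHom (dvd_pow_self p k.succ_ne_zero) (ZMod p)) n)
    rw [MonoidHom.mem_ker, this]
    rfl
  refine not_admitsRamificationStructure_of_mem_zpowers M ?_ (mk hu 0 (p ^ k)) ?_ ?_
  · intro h
    have := (hmem 0 1).1 (h ▸ Subgroup.mem_top _)
    exact hp.one_lt.ne' (Nat.dvd_one.1 this)
  · rw [one_eq_mk, Ne, mk_inj, Nat.cast_zero, ZMod.natCast_eq_zero_iff,
      Nat.pow_dvd_pow_iff_le_right hp.one_lt]
    omega
  · intro g hg
    obtain ⟨a, n, rfl⟩ := exists_eq_mk g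
    rw [hmem] at hg
    obtain ⟨c, -, hc⟩ := Nat.exists_mul_mod_eq_one_of_coprime
      ((hp.coprime_iff_not_dvd.2 hg).symm) hp.one_lt
    replace hc : n * c ≡ 1 [MOD p] := hc.trans (Nat.mod_eq_of_lt hp.one_lt).symm
    -- The `p ^ k`-th power kills `a` and leaves `p ^ k * n`; the inverse `c` of `n` mod `p` then
    -- turns this into `p ^ k`.
    refine Subgroup.mem_zpowers_iff.2 ⟨(p ^ k * c : ℕ), ?_⟩
    rw [zpow_natCast, pow_mul, mk_pow, htr n fun h => hg ((dvd_pow_self p hk).trans h), zero_mul,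
      mk_pow, mul_zero, mk_inj]
    refine ⟨rfl, (ZMod.natCast_eq_natCast_iff _ _ _).2 ?_⟩
    have := hc.mul_left' (p ^ k)
    rw [mul_one, ← pow_succ] at this
    convert this using 1
    ring

/-- If `p ^ k ∣ n`, the element acts trivially on `R` and powers are computed coordinatewise;
otherwise its `p ^ k`-th power already has no `R`-component. -/
theorem pow_pow_eq_mk
    (htr : ∀ n : ℕ, ¬ p ^ k ∣ n → ∑ i ∈ Finset.range (p ^ k), ((u : R) ^ n) ^ i = 0)
    (huk : u ^ p ^ k = 1) {l : ℕ} (hl : k + 1 ≤ l) (a : R) (n : ℕ) :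
    mk hu a n ^ p ^ l = 1 ∨ mk hu a n ^ p ^ l = mk hu (p ^ l * a) 0 := by
  obtain ⟨d, rfl⟩ := Nat.exists_eq_add_of_le hl
  have hcast (c : ℕ) : ((p ^ (k + 1) * c : ℕ) : ZMod (p ^ (k + 1))) = 0 := by
    rw [Nat.cast_mul, ZMod.natCast_self, zero_mul]
  by_cases h : p ^ k ∣ n
  · right
    obtain ⟨c, rfl⟩ := h
    have hone : (u : R) ^ (p ^ k * c) = 1 := by
      rw [pow_mul, ← Units.val_pow_eq_pow_val, huk, Units.val_one, one_pow]
    rw [mk_pow_of_pow_eq_one _ _ _ hone, mk_inj, pow_add, mul_assoc, hcast]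
    simp [pow_add]
  · left
    have hexp : p ^ (k + 1 + d) = p ^ k * (p * p ^ d) := by ring
    rw [congrArg (mk hu a n ^ ·) hexp, pow_mul, mk_pow, htr n h, zero_mul, mk_pow, mul_zero,
      one_eq_mk, mk_inj, Nat.cast_zero, ← hcast (p ^ d * n)]
    exact ⟨rfl, congrArg Nat.cast (by ring)⟩

end UnitExtension

end UnitExtension

/-! ### Finite quotients of the cyclotomic integers -/

open NumberField in
theorem exists_finite_ring_with_unit (p : ℕ) [Fact p.Prime] (m e : ℕ) (hm : 1 ≤ m) :
    ∃ (R : Type) (_ : CommRing R) (_ : Finite R) (u : Rˣ), u ≠ 1 ∧ u ^ p ^ (m + 1) = 1 ∧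
      (∀ n : ℕ, ¬ p ^ (m + 1) ∣ n →
        ∑ i ∈ Finset.range (p ^ (m + 1)), ((u : R) ^ n) ^ i = 0) ∧
      (∀ S : AddSubgroup R, 1 ∈ S → (∀ a ∈ S, (u : R) * a ∈ S) → S = ⊤) ∧
      (p : R) ^ (e + 2) = 0 ∧
      (Set.range fun a : R => (p : R) ^ (e + 1) * a).ncard = p ^ m := by
  have hp : p.Prime := Fact.out
  set q := p ^ (m + 1) with hq
  have : NeZero q := ⟨pow_ne_zero _ hp.ne_zero⟩
  let K := CyclotomicField q ℚ
  have hK : IsCyclotomicExtension {p ^ (m + 1)} ℚ K := CyclotomicField.isCyclotomicExtension q ℚ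
  have hζ : IsPrimitiveRoot (IsCyclotomicExtension.zeta q ℚ K) (p ^ (m + 1)) :=
    IsCyclotomicExtension.zeta_spec q ℚ K
  set ζ : 𝓞 K := hζ.toInteger with hζdef
  have hζ' : IsPrimitiveRoot ζ q := hζ.toInteger_isPrimitiveRoot
  have hp0 : (p : 𝓞 K) ≠ 0 := Nat.cast_ne_zero.2 hp.ne_zero
  have hπ0 : ζ - 1 ≠ 0 := hζ.zeta_sub_one_prime.ne_zero
  -- `p` is associated to a power of `ζ - 1` with exponent `φ(q) ≥ m`.
  have hπp : (ζ - 1) ^ m ∣ (p : 𝓞 K) := by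
    have h := IsCyclotomicExtension.Rat.map_eq_span_zeta_sub_one_pow p m hζ
    rw [Ideal.map_span, Set.image_singleton, Ideal.span_singleton_pow,
      Ideal.span_singleton_eq_span_singleton] at h
    have hm' : m ≤ Module.finrank ℚ K := by
      rw [IsCyclotomicExtension.Rat.finrank q K, hq, Nat.totient_prime_pow_succ hp]
      exact (Nat.lt_pow_self hp.one_lt).le.trans
        (Nat.le_mul_of_pos_right _ (Nat.sub_pos_of_lt hp.one_lt))
    simpa using (pow_dvd_pow (ζ - 1) hm').trans h.symm.dvd
  let I : Ideal (𝓞 K) := Ideal.span {(p : 𝓞 K) ^ (e + 1) * (ζ - 1) ^ m}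
  have hI : I ≠ ⊥ := by
    simpa [I] using ⟨fun h => absurd h hp.ne_zero, fun h => absurd h hπ0⟩
  have hfin : Finite (𝓞 K ⧸ I) := Ideal.finiteQuotientOfFreeOfNeBot I hI
  let f : 𝓞 K →+* 𝓞 K ⧸ I := Ideal.Quotient.mk I
  have hf : Function.Surjective f := Ideal.Quotient.mk_surjective
  have hf0 (x : 𝓞 K) : f x = 0 ↔ (p : 𝓞 K) ^ (e + 1) * (ζ - 1) ^ m ∣ x := by
    rw [Ideal.Quotient.eq_zero_iff_mem, Ideal.mem_span_singleton]
  have hfp : f ((p : 𝓞 K) ^ (e + 2)) = 0 := by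
    rw [hf0, show e + 2 = (e + 1) + 1 from rfl, pow_succ _ (e + 1)]
    exact mul_dvd_mul_left _ hπp
  let v : (𝓞 K)ˣ := (hζ'.isUnit (NeZero.ne q)).unit
  have hv : (v : 𝓞 K) = ζ := rfl
  let u : (𝓞 K ⧸ I)ˣ := Units.map f v
  have hu : (u : 𝓞 K ⧸ I) = f ζ := rfl
  refine ⟨𝓞 K ⧸ I, inferInstance, hfin, u, ?_, ?_, ?_, ?_, ?_, ?_⟩
  · intro h
    have h1 : f (ζ - 1) = 0 := by rw [map_sub, ← hu, h, map_one, Units.val_one, sub_self]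
    obtain ⟨c, hc⟩ := (hf0 _).1 h1
    obtain ⟨d, rfl⟩ := Nat.exists_eq_add_of_le' hm
    have hunit : (p : 𝓞 K) * ((p : 𝓞 K) ^ e * (ζ - 1) ^ d * c) = 1 :=
      -- As `m ≥ 1`, cancelling `ζ - 1` would make `p` a unit.
      mul_left_cancel₀ hπ0 (by rw [mul_one]; exact .trans (by ring) hc.symm)
    exact hζ.zeta_sub_one_prime.not_isUnit (isUnit_of_dvd_unit
      ((dvd_pow_self _ d.succ_ne_zero).trans hπp) (IsUnit.of_mul_eq_one _ hunit))
  · ext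
    rw [Units.val_pow_eq_pow_val, hu, ← map_pow, hζ'.pow_eq_one, map_one, Units.val_one]
  · intro n hn
    have h1 : ζ ^ n - 1 ≠ 0 := fun h => hn (hζ'.dvd_of_pow_eq_one n (sub_eq_zero.1 h))
    have h2 : ∑ i ∈ Finset.range q, (ζ ^ n) ^ i = 0 := by
      refine (mul_eq_zero.1 ((geom_sum_mul (ζ ^ n) q).trans ?_)).resolve_right h1
      rw [← pow_mul, mul_comm, pow_mul, hζ'.pow_eq_one, one_pow, sub_self]
    simpa [hu] using congrArg f h2
  · intro S h1 hS
    have hpow (n : ℕ) : f ζ ^ n ∈ S := by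
      induction n with
      | zero => simpa using h1
      | succ n ih => rw [pow_succ']; exact hS _ ih
    rw [eq_top_iff]
    rintro x -
    obtain ⟨y, rfl⟩ := hf x
    have hy : y ∈ Algebra.adjoin ℤ {ζ} := by
      rw [IsCyclotomicExtension.Rat.adjoin_singleton_eq_top hζ]
      trivial
    obtain ⟨P, rfl⟩ := Algebra.adjoin_mem_exists_aeval ℤ ζ hy
    rw [Polynomial.aeval_eq_sum_range, map_sum]
    refine S.sum_mem fun i _ => ?_
    rw [map_zsmul, map_pow]
    exact S.zsmul_mem (hpow i) _
  · simpa using hfp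
  · let g : 𝓞 K →ₗ[𝓞 K] 𝓞 K ⧸ I :=
      I.mkQ ∘ₗ LinearMap.mulLeft (𝓞 K) ((p : 𝓞 K) ^ (e + 1))
    have hg (x : 𝓞 K) : g x = (p : 𝓞 K ⧸ I) ^ (e + 1) * f x := by
      have : g x = f ((p : 𝓞 K) ^ (e + 1) * x) := rfl
      rw [this, map_mul, map_pow, map_natCast]
    -- Cancelling `p ^ (e + 1)` leaves `(ζ - 1) ^ m`, an ideal of norm `p ^ m`.
    have hker : LinearMap.ker g = Ideal.span {ζ - 1} ^ m := by
      ext x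
      have : g x = f ((p : 𝓞 K) ^ (e + 1) * x) := rfl
      rw [LinearMap.mem_ker, this, hf0, mul_dvd_mul_iff_left (pow_ne_zero _ hp0),
        Ideal.span_singleton_pow, Ideal.mem_span_singleton]
    have hrange : (Set.range fun a => (p : 𝓞 K ⧸ I) ^ (e + 1) * a) = LinearMap.range g := by
      ext y
      simp only [Set.mem_range, SetLike.mem_coe, LinearMap.mem_range, hg]
      exact (hf.exists (p := fun a => (p : 𝓞 K ⧸ I) ^ (e + 1) * a = y))
    rw [hrange]
    change Nat.card (LinearMap.range g) = p ^ m
    rw [← Nat.card_congr g.quotKerEquivRange.toEquiv, hker, ← Submodule.cardQuot_apply,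
      ← Ideal.absNorm_apply, map_pow,
      IsCyclotomicExtension.Rat.absNorm_span_zeta_sub_one]

/-! ### Choice of parameters -/

theorem mainTheorem8 (p : ℕ) (hp : p.Prime) (hp5 : 5 ≤ p) (m : ℕ) (hm : 1 ≤ m) :
    ∃ (G : Type) (_ : Group G) (_ : Finite G),
      IsPGroup p G ∧
      Group.rank G = 2 ∧
      (∃ e : ℕ, 1 ≤ e ∧ Monoid.exponent G = p ^ e ∧
        (Set.range (fun g : G => g ^ p ^ (e - 1))).ncard = p ^ m) ∧
      ¬ AdmitsRamificationStructure G := by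
  have : Fact p.Prime := ⟨hp⟩
  -- With `e = m + 1`, the factor `p ^ (e + 1)` is exactly the order of the acting cyclic group, so
  -- only `R` contributes to the last non-trivial powers.
  obtain ⟨R, _, _, u, hu1, huq, htr, hgen, hpe, hcard⟩ :=
    exists_finite_ring_with_unit p m (m + 1) hm
  have hu : u ^ p ^ (m + 1 + 1) = 1 := by rw [pow_succ, pow_mul, huq, one_pow]
  have : NeZero (p ^ (m + 1 + 1)) := ⟨pow_ne_zero _ hp.ne_zero⟩
  have hexp (g : UnitExtension (p ^ (m + 1 + 1)) u hu) : g ^ p ^ (m + 1 + 2) = 1 := by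
    obtain ⟨a, n, rfl⟩ := UnitExtension.exists_eq_mk g
    obtain h | h := UnitExtension.pow_pow_eq_mk (hu := hu) htr huq
      (show m + 1 + 1 ≤ m + 1 + 2 by omega) a n
    · exact h
    · rw [h, hpe, zero_mul, ← UnitExtension.one_eq_mk]
  have hrange : Set.range (fun g : UnitExtension (p ^ (m + 1 + 1)) u hu => g ^ p ^ (m + 1 + 1)) =
      (fun a => UnitExtension.mk hu a 0) ''
        Set.range fun a : R => (p : R) ^ (m + 1 + 1) * a := by
    ext g
    constructor
    · rintro ⟨g, rfl⟩
      obtain ⟨a, n, rfl⟩ := UnitExtension.exists_eq_mk g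
      obtain h | h := UnitExtension.pow_pow_eq_mk (hu := hu) htr huq le_rfl a n
      · exact ⟨0, ⟨0, mul_zero _⟩, UnitExtension.one_eq_mk.symm.trans h.symm⟩
      · exact ⟨_, ⟨a, rfl⟩, h.symm⟩
    · rintro ⟨_, ⟨a, rfl⟩, rfl⟩
      refine ⟨UnitExtension.mk hu a 0, ?_⟩
      simp [UnitExtension.mk_pow_of_pow_eq_one]
  have hncard : (Set.range fun g : UnitExtension (p ^ (m + 1 + 1)) u hu =>
      g ^ p ^ (m + 1 + 1)).ncard = p ^ m := by
    rw [hrange, Set.ncard_image_of_injective _ fun a b h => ((UnitExtension.mk_inj ..).1 h).1,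
      hcard]
  refine ⟨UnitExtension (p ^ (m + 1 + 1)) u hu, inferInstance, inferInstance,
    fun g => ⟨_, hexp g⟩, UnitExtension.rank_eq_two hu1 hgen,
    ⟨m + 1 + 2, by omega, ?_, hncard⟩,
    UnitExtension.not_admitsRamificationStructure hp htr m.succ_ne_zero⟩
  obtain ⟨l, hl, hle⟩ :=
    (Nat.dvd_prime_pow hp).1 (Monoid.exponent_dvd_of_forall_pow_eq_one hexp)
  refine hle.trans (congrArg (p ^ ·) (hl.antisymm (Nat.le_of_not_lt fun hlt => ?_)))
  -- A smaller exponent would leave only one such power, against `p ^ m > 1`.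
  have htriv (g : UnitExtension (p ^ (m + 1 + 1)) u hu) : g ^ p ^ (m + 1 + 1) = 1 :=
    Monoid.exponent_dvd_iff_forall_pow_eq_one.1
      (hle ▸ pow_dvd_pow p (by omega : l ≤ m + 1 + 1)) g
  simp only [htriv, Set.range_const, Set.ncard_singleton] at hncard
  exact (Nat.one_lt_pow (by omega) hp.one_lt).ne hncard
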